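/- Theorem 4.1. Let $d\ge 1$, $T>0$, and let $u_0:\mathbb R^d\to\mathbb R$ be bounded and uniformly continuous. Let $e_1,\dots,e_d$ be the standard basis of $\mathbb R^d$ and $A=\{0,\pm e_1,\dots,\pm e_d\}\subset\mathbb Z^d$. For $\varepsilon>0$ let $w_\varepsilon:\mathbb Z^d\times\{0,1,2,\dots\}\to\mathbb R$ be the deterministic directed last-passage growth model $$w_\varepsilon(k,0)=u_0(\varepsilon k),\qquad w_\varepsilon(k,n+1)=\max_{a\in A}w_\varepsilon(k+a,n),$$ and set, for $(x,t)\in\mathbb R^d\times[0,T]$, $$u^\varepsilon(x,t)=w_\varepsilon\big(\lfloor x/\varepsilon\rfloor,\lfloor t/\varepsilon\rfloor\big),$$ where $\lfloor\cdot\rfloor$ is the integer part (floor), applied to each coordinate of $x/\varepsilon$. Let $H(p)=\max_{1\le i\le d}|p_i|$ for $p\in\mathbb R^d$. Write $\mathrm{BUC}$ for the space of bounded uniformly continuous real functions. A function $u\in \mathrm{BUC}(\mathbb R^d\times[0,T])$ is called a viscosity solution of $$u_t=H(Du)\ \text{ in }\mathbb R^d\times(0,T],\qquad u(\cdot,0)=u_0\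 \text{ in }\mathbb R^d,\qquad(*)$$ if $u(\cdot,0)=u_0$ and, for all $\phi\in C^2(\mathbb R^d)$, all $g\in C^1((0,T])$ and all $(x_0,t_0)\in\mathbb R^d\times(0,T]$: if $(x_0,t_0)$ is a maximum point of $u(x,t)-\phi(x)-g(t)$ over $\mathbb R^d\times(0,T]$, then $g'(t_0)\le H(D\phi(x_0))$; and if it is a minimum point of this function over $\mathbb R^d\times(0,T]$, then $g'(t_0)\ge H(D\phi(x_0))$. (At $t_0=T$, $g'$ is the one-sided derivative.) Then $(*)$ has exactly one viscosity solution $u\in \mathrm{BUC}(\mathbb R^d\times[0,T])$, and $u^\varepsilon\to u$ as $\varepsilon\to0^+$, locally uniformly in $\mathbb R^d\times[0,T]$. -/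

import Mathlib

open Set Filter Topology
open scoped Gradient

noncomputable section

namespace LastPassage

/-- Euclidean space `ℝ^d`. -/
abbrev Space (d : ℕ) : Type := EuclideanSpace ℝ (Fin d)

/-- The set `A = {0, ± e_1, …, ± e_d}` of the origin and its `2d` nearest neighbours in `ℤ^d`. -/
def nbhd (d : ℕ) : Finset (Fin d → ℤ) :=
  insert 0 (Finset.univ.image (fun i : Fin d => Pi.single i (1 : ℤ)) ∪
    Finset.univ.image (fun i : Fin d => -Pi.single i (1 : ℤ)))

theorem zero_mem_nbhd (d : ℕ) : (0 : Fin d → ℤ) ∈ nbhd d :=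
  Finset.mem_insert_self _ _

/-- The driving function `w ↦ max_{a ∈ A} w_a` of directed last-passage percolation. -/
def driving (d : ℕ) (w : nbhd d → ℝ) : ℝ :=
  Finset.univ.sup' ⟨⟨0, zero_mem_nbhd d⟩, Finset.mem_univ _⟩ w

/-- The discrete surface on `ℤ^d × ℤ_+` with initial surface `h` that is driven by `φ`:
`u(x, 0) = h(x)` and `u(x, t + 1) = φ((u(x + a, t))_{a ∈ A})`. The time is the first argument
after `h`. -/
def surface {d : ℕ} (φ : (nbhd d → ℝ) → ℝ) (h : (Fin d → ℤ) → ℝ) : ℕ → (Fin d → ℤ) → ℝ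
  | 0, x => h x
  | t + 1, x => φ (fun a => surface φ h t (x + a))

/-- The point `ε k` of `ℝ^d`, for `k ∈ ℤ^d`. -/
def latticePoint {d : ℕ} (ε : ℝ) (k : Fin d → ℤ) : Space d :=
  WithLp.toLp 2 (fun i => ε * (k i : ℝ))

/-- The hyperbolically rescaled height function `u^ε(x, t) = u([x/ε], [t/ε])` (for `t ≥ 0`), where
`u` is the last-passage surface with `u(k, 0) = u₀(ε k)`, and the integer part is the floor,
taken coordinatewise. -/
def scaledHeight {d : ℕ} (u₀ : Space d → ℝ) (ε : ℝ) (z : Space d × ℝ) : ℝ :=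
  surface (driving d) (fun k => u₀ (latticePoint ε k)) ⌊z.2 / ε⌋₊ (fun i => ⌊z.1 i / ε⌋)

/-- The Hamiltonian `H(p) = max_i |p_i|`. -/
def hamiltonian (d : ℕ) (p : Space d) : ℝ := ⨆ i, |p i|

/-- `f` is bounded and uniformly continuous on `s`. -/
def IsBUCOn {X : Type*} [UniformSpace X] (f : X → ℝ) (s : Set X) : Prop :=
  (∃ C : ℝ, ∀ x ∈ s, |f x| ≤ C) ∧ UniformContinuousOn f s

/-- `u` is a viscosity subsolution of `u_t = H(Du)` on `ℝ^d × (0, T]`. The derivative of the test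
function `g ∈ C^1((0, T])` is one-sided at `T`. -/
def IsSubsolution {d : ℕ} (H : Space d → ℝ) (T : ℝ) (u : Space d × ℝ → ℝ) : Prop :=
  UpperSemicontinuousOn u (univ ×ˢ Ioc 0 T) ∧
    ∀ (φ : Space d → ℝ) (g : ℝ → ℝ), ContDiff ℝ 2 φ → ContDiffOn ℝ 1 g (Ioc 0 T) →
      ∀ (x₀ : Space d) (t₀ : ℝ), t₀ ∈ Ioc 0 T →
        IsMaxOn (fun z : Space d × ℝ => u z - φ z.1 - g z.2) (univ ×ˢ Ioc 0 T) (x₀, t₀) →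
          derivWithin g (Ioc 0 T) t₀ ≤ H (∇ φ x₀)

/-- `u` is a viscosity supersolution of `u_t = H(Du)` on `ℝ^d × (0, T]`. -/
def IsSupersolution {d : ℕ} (H : Space d → ℝ) (T : ℝ) (u : Space d × ℝ → ℝ) : Prop :=
  LowerSemicontinuousOn u (univ ×ˢ Ioc 0 T) ∧
    ∀ (φ : Space d → ℝ) (g : ℝ → ℝ), ContDiff ℝ 2 φ → ContDiffOn ℝ 1 g (Ioc 0 T) →
      ∀ (x₀ : Space d) (t₀ : ℝ), t₀ ∈ Ioc 0 T →
        IsMinOn (fun z : Space d × ℝ => u z - φ z.1 - g z.2) (univ ×ˢ Ioc 0 T) (x₀, t₀) →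
          H (∇ φ x₀) ≤ derivWithin g (Ioc 0 T) t₀

/-- `u ∈ BUC(ℝ^d × [0, T])` is a viscosity solution of `u_t = H(Du)`, `u(·, 0) = u₀`. Only the
values of `u` on `ℝ^d × [0, T]` matter. -/
structure IsBUCSolution {d : ℕ} (H : Space d → ℝ) (T : ℝ) (u₀ : Space d → ℝ)
    (u : Space d × ℝ → ℝ) : Prop where
  buc : IsBUCOn u (univ ×ˢ Icc 0 T)
  sub : IsSubsolution H T u
  super : IsSupersolution H T u
  initial : ∀ x, u (x, 0) = u₀ x

end LastPassage

end

/-!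
The unique solution is given by the Hopf–Lax formula. The Hamiltonian `H(p) = max_i |p_i|` is the
support function of the closed `ℓ¹` unit ball `B` (the cross-polytope), so the candidate is
`u(x, t) = max_{b ∈ B} u₀(x + t b)`.

*Existence.* Convexity of `B` gives `u(x + s b, t - s) ≤ u(x, t)` for every `b ∈ B` and
`0 ≤ s ≤ t` (`hopfLax_step_le`), and a `b` that attains the maximum in the formula for `u(x, t)`
gives equality for all these `s` at once (`exists_characteristic`).
If `u - φ - g` has an extremum at `(x₀, t₀)`, then
`s ↦ φ(x₀ + s b) + g(t₀ - s)` has a one-sided extremum at `s = 0`, and its one-sided derivative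
`Dφ(x₀) b - g'(t₀)` has a sign: this is the subsolution inequality for the maximizing direction
`b`, and the supersolution inequality for `b = ± e_i`.

*Uniqueness.* The comparison principle `comparison` is proved by doubling the variables. It holds
for every Hamiltonian that is `1`-Lipschitz; the test functions that the doubling produces are
quadratic in `x` plus quadratic in `t`.

*Convergence.* The lattice model satisfies the same dynamic programming principle, so induction on
time gives `w_ε(k, n) ≤ u(ε k, ε n)` (`surface_le_hopfLax`) and `u₀(ε (k + j)) ≤ w_ε(k, n)` for
lattice points `j` with `|j|₁ ≤ n` (`le_surface`). Rounding the coordinates of `n b` towards zero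
gives such a `j` within bounded distance of `n b`, so the two bounds differ by at most the
oscillation of `u₀` at scale `ε d`; the convergence is uniform on `ℝ^d × [0, T]`.
-/

namespace LastPassage

/-! ### The cross-polytope and its support function -/

/-- The closed unit ball of the `ℓ¹` norm in `ℝ^d`, the convex hull of `± e_1, …, ± e_d`. -/
def crossPolytope (d : ℕ) : Set (Space d) := {b | ∑ i, |b i| ≤ 1}

theorem norm_le_sum_abs {d : ℕ} (x : Space d) : ‖x‖ ≤ ∑ i, |x i| := by
  have h0 : 0 ≤ ∑ i, |x i| := Finset.sum_nonneg fun i _ => abs_nonneg _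
  refine le_of_sq_le_sq ?_ h0
  rw [EuclideanSpace.norm_sq_eq]
  exact Finset.sum_sq_le_sq_sum_of_nonneg fun i _ => norm_nonneg _

theorem norm_le_one_of_mem_crossPolytope {d : ℕ} {b : Space d} (hb : b ∈ crossPolytope d) :
    ‖b‖ ≤ 1 :=
  (norm_le_sum_abs b).trans hb

theorem zero_mem_crossPolytope (d : ℕ) : (0 : Space d) ∈ crossPolytope d := by
  simp [crossPolytope]

instance (d : ℕ) : Nonempty (crossPolytope d) := ⟨⟨0, zero_mem_crossPolytope d⟩⟩

theorem neg_mem_crossPolytope {d : ℕ} {b : Space d} (hb : b ∈ crossPolytope d) :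
    -b ∈ crossPolytope d := by
  simpa [crossPolytope] using hb

theorem single_mem_crossPolytope {d : ℕ} (i : Fin d) :
    EuclideanSpace.single i (1 : ℝ) ∈ crossPolytope d := by
  have : ∀ j, |(EuclideanSpace.single i (1 : ℝ) : Space d) j| = if j = i then 1 else 0 := by
    intro j
    by_cases h : j = i <;> simp [h]
  simp only [crossPolytope, mem_ofPred_eq, this]
  simp

theorem isCompact_crossPolytope (d : ℕ) : IsCompact (crossPolytope d) := by
  refine Metric.isCompact_of_isClosed_isBounded ?_ ?_
  · exact isClosed_le (by fun_prop) continuous_const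
  · refine (Metric.isBounded_closedBall (x := (0 : Space d)) (r := 1)).subset fun b hb => ?_
    simpa using norm_le_one_of_mem_crossPolytope hb

theorem convex_crossPolytope (d : ℕ) : Convex ℝ (crossPolytope d) := by
  intro x hx y hy a c ha hc hac
  calc ∑ i, |(a • x + c • y) i| ≤ ∑ i, (a * |x i| + c * |y i|) := by
        refine Finset.sum_le_sum fun i _ => ?_
        simpa [abs_mul, abs_of_nonneg ha, abs_of_nonneg hc] using abs_add_le (a * x i) (c * y i)
    _ = a * ∑ i, |x i| + c * ∑ i, |y i| := by
        rw [Finset.sum_add_distrib, Finset.mul_sum, Finset.mul_sum]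
    _ ≤ a * 1 + c * 1 := by
        gcongr
        · exact hx
        · exact hy
    _ = 1 := by rw [mul_one, mul_one, hac]

theorem abs_apply_le_hamiltonian {d : ℕ} (p : Space d) (i : Fin d) : |p i| ≤ hamiltonian d p :=
  le_ciSup (f := fun i => |p i|) (Set.finite_range _).bddAbove i

theorem hamiltonian_nonneg {d : ℕ} (p : Space d) : 0 ≤ hamiltonian d p :=
  Real.iSup_nonneg fun i => abs_nonneg (p i)

theorem inner_le_hamiltonian {d : ℕ} (p : Space d) {b : Space d} (hb : b ∈ crossPolytope d) :
    inner ℝ p b ≤ hamiltonian d p := by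
  calc inner ℝ p b = ∑ i, b i * p i := by simp [PiLp.inner_apply]
    _ ≤ ∑ i, |b i| * hamiltonian d p := by
        refine Finset.sum_le_sum fun i _ => (le_abs_self _).trans ?_
        rw [abs_mul]
        exact mul_le_mul_of_nonneg_left (abs_apply_le_hamiltonian p i) (abs_nonneg _)
    _ = (∑ i, |b i|) * hamiltonian d p := by rw [Finset.sum_mul]
    _ ≤ 1 * hamiltonian d p := mul_le_mul_of_nonneg_right hb (hamiltonian_nonneg p)
    _ = hamiltonian d p := one_mul _

theorem hamiltonian_le_of_inner_le {d : ℕ} (hd : 1 ≤ d) {p : Space d} {c : ℝ}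
    (h : ∀ b ∈ crossPolytope d, inner ℝ p b ≤ c) : hamiltonian d p ≤ c := by
  have : Nonempty (Fin d) := ⟨⟨0, hd⟩⟩
  refine ciSup_le fun i => abs_le'.2 ⟨?_, ?_⟩
  · simpa [EuclideanSpace.inner_single_right] using h _ (single_mem_crossPolytope i)
  · simpa [EuclideanSpace.inner_single_right] using
      h _ (neg_mem_crossPolytope (single_mem_crossPolytope i))

theorem hamiltonian_le_add_norm_sub {d : ℕ} (hd : 1 ≤ d) (p q : Space d) :
    hamiltonian d p ≤ hamiltonian d q + ‖p - q‖ := by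
  have : Nonempty (Fin d) := ⟨⟨0, hd⟩⟩
  refine ciSup_le fun i => ?_
  have h1 : |(p - q) i| ≤ ‖p - q‖ := PiLp.norm_apply_le (p - q) i
  have h2 : |p i| ≤ |q i| + |(p - q) i| := by
    simpa using abs_add_le (q i) ((p - q) i)
  linarith [abs_apply_le_hamiltonian q i]

/-! ### The Hopf–Lax formula -/

/-- The Hopf–Lax function `u(x, t) = sup_{|b|₁ ≤ 1} u₀(x + t b)`. Scaling a fixed ball, instead of
taking the supremum over the ball of radius `t`, keeps the index set nonempty for every `t`. -/
noncomputable def hopfLax {d : ℕ} (u₀ : Space d → ℝ) (z : Space d × ℝ) : ℝ :=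
  ⨆ b : crossPolytope d, u₀ (z.1 + z.2 • (b : Space d))

section HopfLax

variable {d : ℕ} {u₀ : Space d → ℝ} {C : ℝ}

theorem le_hopfLax (hC : ∀ x, |u₀ x| ≤ C) (x : Space d) (t : ℝ) {b : Space d}
    (hb : b ∈ crossPolytope d) : u₀ (x + t • b) ≤ hopfLax u₀ (x, t) :=
  le_ciSup (f := fun b : crossPolytope d => u₀ (x + t • (b : Space d)))
    ⟨C, by rintro _ ⟨c, rfl⟩; exact (abs_le.1 (hC _)).2⟩ ⟨b, hb⟩

theorem hopfLax_le {x : Space d} {t c : ℝ} (h : ∀ b ∈ crossPolytope d, u₀ (x + t • b) ≤ c) :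
    hopfLax u₀ (x, t) ≤ c :=
  ciSup_le fun b => h b b.2

theorem hopfLax_zero (x : Space d) : hopfLax u₀ (x, 0) = u₀ x := by
  simp [hopfLax]

theorem exists_hopfLax_eq (hC : ∀ x, |u₀ x| ≤ C) (hcont : Continuous u₀) (x : Space d) (t : ℝ) :
    ∃ b ∈ crossPolytope d, hopfLax u₀ (x, t) = u₀ (x + t • b) := by
  obtain ⟨b, hb, hmax⟩ := (isCompact_crossPolytope d).exists_isMaxOn
    ⟨0, zero_mem_crossPolytope d⟩
    (f := fun b => u₀ (x + t • b)) (by fun_prop)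
  exact ⟨b, hb, le_antisymm (hopfLax_le fun c hc => hmax hc) (le_hopfLax hC x t hb)⟩

/-- One half of the dynamic programming principle: information travels along every direction of
the cross-polytope. -/
theorem hopfLax_step_le (hC : ∀ x, |u₀ x| ≤ C) (x : Space d) {s t : ℝ} (hs : 0 ≤ s) (ht : 0 ≤ t)
    {b : Space d} (hb : b ∈ crossPolytope d) :
    hopfLax u₀ (x + s • b, t) ≤ hopfLax u₀ (x, t + s) := by
  refine hopfLax_le fun c hc => ?_
  rcases hs.eq_or_lt with rfl | hs
  · simpa using le_hopfLax hC x t hc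
  have hts : 0 < t + s := by linarith
  have hmem : (t / (t + s)) • c + (s / (t + s)) • b ∈ crossPolytope d :=
    convex_crossPolytope d hc hb (by positivity) (by positivity) (by field_simp)
  have heq : x + s • b + t • c = x + (t + s) • ((t / (t + s)) • c + (s / (t + s)) • b) := by
    rw [smul_add, smul_smul, smul_smul, mul_div_cancel₀ _ hts.ne', mul_div_cancel₀ _ hts.ne']
    abel
  rw [heq]
  exact le_hopfLax hC x (t + s) hmem

/-- The other half of the dynamic programming principle: some direction is optimal for all
intermediate times simultaneously. -/
theorem exists_characteristic (hC : ∀ x, |u₀ x| ≤ C) (hcont : Continuous u₀) (x : Space d)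
    (t : ℝ) : ∃ b ∈ crossPolytope d,
      ∀ s : ℝ, hopfLax u₀ (x, t) ≤ hopfLax u₀ (x + s • b, t - s) := by
  obtain ⟨b, hb, h⟩ := exists_hopfLax_eq hC hcont x t
  refine ⟨b, hb, fun s => ?_⟩
  have heq : x + t • b = x + s • b + (t - s) • b := by rw [sub_smul]; abel
  rw [h, heq]
  exact le_hopfLax hC _ _ hb

theorem abs_hopfLax_le (hC : ∀ x, |u₀ x| ≤ C) (z : Space d × ℝ) : |hopfLax u₀ z| ≤ C := by
  refine abs_le.2 ⟨?_, hopfLax_le fun b _ => (abs_le.1 (hC _)).2⟩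
  exact (abs_le.1 (hC _)).1.trans (le_hopfLax hC z.1 z.2 (zero_mem_crossPolytope d))

/-- The Hopf–Lax function inherits every modulus of continuity of `u₀`. -/
theorem hopfLax_le_add (hC : ∀ x, |u₀ x| ≤ C) {η δ : ℝ}
    (hδ : ∀ x y, dist x y < δ → |u₀ x - u₀ y| ≤ η) {x y : Space d} {s t : ℝ}
    (h : ‖x - y‖ + |t - s| < δ) : hopfLax u₀ (x, t) ≤ hopfLax u₀ (y, s) + η := by
  refine hopfLax_le fun b hb => ?_
  have hdist : dist (x + t • b) (y + s • b) < δ := by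
    rw [dist_eq_norm]
    have heq : x + t • b - (y + s • b) = (x - y) + (t - s) • b := by rw [sub_smul]; abel
    rw [heq]
    refine (norm_add_le _ _).trans_lt (lt_of_le_of_lt ?_ h)
    rw [norm_smul, Real.norm_eq_abs]
    have := mul_le_of_le_one_right (abs_nonneg (t - s)) (norm_le_one_of_mem_crossPolytope hb)
    linarith
  linarith [(abs_le.1 (hδ _ _ hdist)).2, le_hopfLax hC y s hb]

theorem abs_hopfLax_sub_le (hC : ∀ x, |u₀ x| ≤ C) {η δ : ℝ}
    (hδ : ∀ x y, dist x y < δ → |u₀ x - u₀ y| ≤ η) {x y : Space d} {s t : ℝ}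
    (h : ‖x - y‖ + |t - s| < δ) : |hopfLax u₀ (x, t) - hopfLax u₀ (y, s)| ≤ η := by
  have h1 := hopfLax_le_add hC hδ h
  have h2 := hopfLax_le_add hC hδ (x := y) (y := x) (s := t) (t := s)
    (by rwa [norm_sub_rev, abs_sub_comm])
  exact abs_le.2 ⟨by linarith, by linarith⟩

theorem exists_modulus (hu₀ : IsBUCOn u₀ univ) {η : ℝ} (hη : 0 < η) :
    ∃ δ > 0, ∀ x y, dist x y < δ → |u₀ x - u₀ y| ≤ η := by
  obtain ⟨δ, hδ, h⟩ := Metric.uniformContinuousOn_iff.1 hu₀.2 η hη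
  exact ⟨δ, hδ, fun x y hxy => (h x trivial y trivial hxy).le⟩

theorem uniformContinuous_hopfLax (hu₀ : IsBUCOn u₀ univ) : UniformContinuous (hopfLax u₀) := by
  obtain ⟨C, hC⟩ := hu₀.1
  rw [Metric.uniformContinuous_iff]
  intro η hη
  obtain ⟨δ, hδ, h⟩ := exists_modulus hu₀ (half_pos hη)
  refine ⟨δ / 2, half_pos hδ, fun {z w} hzw => ?_⟩
  rw [Prod.dist_eq, max_lt_iff, dist_eq_norm, Real.dist_eq] at hzw
  refine (abs_hopfLax_sub_le (fun x => hC x trivial) h ?_).trans_lt (half_lt_self hη)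
  linarith [hzw.1, hzw.2]

/-! ### The Hopf–Lax function is a viscosity solution -/

/-- First-order condition at the endpoint `s = 0` of a backward characteristic
`s ↦ (x₀ + s b, t₀ - s)`. It only involves times up to `t₀`, so the one-sided derivative of `g` at
the terminal time needs no separate treatment. -/
theorem derivWithin_le_fderiv {φ : Space d → ℝ} {g : ℝ → ℝ} {T t₀ : ℝ} {x₀ b : Space d}
    (hφ : DifferentiableAt ℝ φ x₀) (hg : DifferentiableWithinAt ℝ g (Ioc 0 T) t₀)
    (ht₀ : t₀ ∈ Ioc 0 T)
    (hmin : ∀ s ∈ Ico 0 t₀, φ x₀ + g t₀ ≤ φ (x₀ + s • b) + g (t₀ - s)) :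
    derivWithin g (Ioc 0 T) t₀ ≤ fderiv ℝ φ x₀ b := by
  have h1 : HasDerivWithinAt (fun s : ℝ => φ (x₀ + s • b)) (fderiv ℝ φ x₀ b) (Ico 0 t₀) 0 := by
    have hline : HasDerivAt (fun s : ℝ => x₀ + s • b) b 0 := by
      simpa using ((hasDerivAt_id (0 : ℝ)).smul_const b).const_add x₀
    have hφ' : HasFDerivAt φ (fderiv ℝ φ x₀) (x₀ + (0 : ℝ) • b) := by
      simpa using hφ.hasFDerivAt
    exact (hφ'.comp_hasDerivAt 0 hline).hasDerivWithinAt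
  have h2 : HasDerivWithinAt (fun s : ℝ => g (t₀ - s)) (-derivWithin g (Ioc 0 T) t₀)
      (Ico 0 t₀) 0 := by
    have hsub : HasDerivWithinAt (fun s : ℝ => t₀ - s) (-1) (Ico 0 t₀) 0 := by
      simpa using ((hasDerivAt_id (0 : ℝ)).const_sub t₀).hasDerivWithinAt
    have hg' : HasDerivWithinAt g (derivWithin g (Ioc 0 T) t₀) (Ioc 0 T) (t₀ - 0) := by
      simpa using hg.hasDerivWithinAt
    have hmaps : MapsTo (fun s : ℝ => t₀ - s) (Ico 0 t₀) (Ioc 0 T) := fun s hs =>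
      ⟨by linarith [hs.2], by linarith [hs.1, ht₀.2]⟩
    simpa [Function.comp_def] using hg'.comp (0 : ℝ) hsub hmaps
  have hlocal : IsLocalMinOn (fun s : ℝ => φ (x₀ + s • b) + g (t₀ - s)) (Ico 0 t₀) 0 := by
    refine IsMinOn.localize fun s hs => ?_
    simpa using hmin s hs
  have hcone : t₀ / 2 ∈ posTangentConeAt (Ico 0 t₀) 0 := by
    refine mem_posTangentConeAt_of_segment_subset ?_
    rw [zero_add, segment_eq_Icc (by linarith [ht₀.1])]
    exact fun s hs => ⟨hs.1, by linarith [hs.2, ht₀.1]⟩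
  have hpos := hlocal.hasFDerivWithinAt_nonneg (h1.add h2).hasFDerivWithinAt hcone
  have hpos' : 0 ≤ t₀ / 2 * (fderiv ℝ φ x₀ b + -derivWithin g (Ioc 0 T) t₀) := by
    simpa using hpos
  linarith [nonneg_of_mul_nonneg_right hpos' (by linarith [ht₀.1])]

theorem inner_gradient {φ : Space d → ℝ} (x b : Space d) :
    inner ℝ (∇ φ x) b = fderiv ℝ φ x b := by
  rw [gradient, InnerProductSpace.toDual_symm_apply]

theorem isBUCSolution_hopfLax (hd : 1 ≤ d) (T : ℝ) (hu₀ : IsBUCOn u₀ univ) :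
    IsBUCSolution (hamiltonian d) T u₀ (hopfLax u₀) := by
  obtain ⟨C, hC'⟩ := hu₀.1
  have hC : ∀ x, |u₀ x| ≤ C := fun x => hC' x trivial
  have hcont : Continuous u₀ := (uniformContinuousOn_univ.1 hu₀.2).continuous
  have huc := uniformContinuous_hopfLax hu₀
  refine ⟨⟨⟨C, fun z _ => abs_hopfLax_le hC z⟩, huc.uniformContinuousOn⟩, ⟨?_, ?_⟩, ⟨?_, ?_⟩,
    hopfLax_zero⟩
  · exact huc.continuous.continuousOn.upperSemicontinuousOn
  · intro φ g hφ hg x₀ t₀ ht₀ hmax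
    obtain ⟨b, hb, hchar⟩ := exists_characteristic hC hcont x₀ t₀
    refine le_trans ?_ (inner_le_hamiltonian (∇ φ x₀) hb)
    rw [inner_gradient]
    refine derivWithin_le_fderiv (hφ.differentiable (by norm_num) x₀)
      (hg.differentiableOn (by norm_num) t₀ ht₀) ht₀ fun s hs => ?_
    have hle : hopfLax u₀ (x₀ + s • b, t₀ - s) - φ (x₀ + s • b) - g (t₀ - s)
        ≤ hopfLax u₀ (x₀, t₀) - φ x₀ - g t₀ :=
      hmax (a := (x₀ + s • b, t₀ - s))
        ⟨trivial, by linarith [hs.2], by linarith [hs.1, ht₀.2]⟩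
    linarith [hchar s]
  · exact huc.continuous.continuousOn.lowerSemicontinuousOn
  · intro φ g hφ hg x₀ t₀ ht₀ hmin
    refine hamiltonian_le_of_inner_le hd fun b hb => ?_
    rw [inner_gradient]
    have key := derivWithin_le_fderiv (φ := fun x => -φ x) (g := fun t => -g t) (b := b)
      (hφ.differentiable (by norm_num) x₀).fun_neg
      (hg.differentiableOn (by norm_num) t₀ ht₀).fun_neg ht₀ fun s hs => ?_
    · rw [derivWithin.fun_neg, fderiv_fun_neg] at key
      simpa using key
    have hle : hopfLax u₀ (x₀, t₀) - φ x₀ - g t₀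
        ≤ hopfLax u₀ (x₀ + s • b, t₀ - s) - φ (x₀ + s • b) - g (t₀ - s) :=
      hmin (a := (x₀ + s • b, t₀ - s))
        ⟨trivial, by linarith [hs.2], by linarith [hs.1, ht₀.2]⟩
    have hstep := hopfLax_step_le hC x₀ hs.1 (t := t₀ - s) (by linarith [hs.2]) hb
    rw [sub_add_cancel] at hstep
    linarith

end HopfLax

/-! ### The comparison principle -/

section Comparison

variable {d : ℕ}

theorem hasGradientAt_quadratic (k δ : ℝ) (x y : Space d) :
    HasGradientAt (fun x => k * ‖x - y‖ ^ 2 + δ * ‖x‖ ^ 2) ((2 * k) • (x - y) + (2 * δ) • x) x := by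
  rw [hasGradientAt_iff_hasFDerivAt]
  have h1 := (((hasFDerivAt_id x).sub_const y).norm_sq).const_mul k
  have h2 := ((hasFDerivAt_id x).norm_sq).const_mul δ
  refine (h1.add h2).congr_fderiv ?_
  ext v
  simp
  ring

theorem contDiff_quadratic (k δ : ℝ) (y : Space d) :
    ContDiff ℝ 2 (fun x : Space d => k * ‖x - y‖ ^ 2 + δ * ‖x‖ ^ 2) := by
  have h1 : ContDiff ℝ 2 (fun x : Space d => ‖x - y‖ ^ 2) :=
    (contDiff_id.sub contDiff_const).norm_sq ℝ
  have h2 : ContDiff ℝ 2 (fun x : Space d => ‖x‖ ^ 2) := contDiff_id.norm_sq ℝ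
  exact (contDiff_const.mul h1).add (contDiff_const.mul h2)

/-- The penalized difference of `v(x, t)` and `w(y, s)` in doubled variables. -/
noncomputable def doubled (v w : Space d × ℝ → ℝ) (k δ η : ℝ)
    (p : (Space d × ℝ) × (Space d × ℝ)) : ℝ :=
  v p.1 - w p.2 - k * ‖p.1.1 - p.2.1‖ ^ 2 - k * (p.1.2 - p.2.2) ^ 2
    - δ * (‖p.1.1‖ ^ 2 + ‖p.2.1‖ ^ 2) - η * p.1.2

/-- The term `δ (|x|² + |y|²)` confines the maximization to a compact set. -/
theorem exists_isMaxOn_doubled {v w : Space d × ℝ → ℝ} {T C k δ η : ℝ} (hT : 0 ≤ T) (hk : 0 ≤ k)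
    (hδ : 0 < δ) (hη : 0 ≤ η) (hv : ContinuousOn v (univ ×ˢ Icc 0 T))
    (hw : ContinuousOn w (univ ×ˢ Icc 0 T)) (hCv : ∀ z ∈ univ ×ˢ Icc 0 T, |v z| ≤ C)
    (hCw : ∀ z ∈ univ ×ˢ Icc 0 T, |w z| ≤ C) :
    ∃ p ∈ ((univ : Set (Space d)) ×ˢ Icc (0 : ℝ) T) ×ˢ ((univ : Set (Space d)) ×ˢ Icc (0 : ℝ) T),
      IsMaxOn (doubled v w k δ η)
        ((univ ×ˢ Icc (0 : ℝ) T) ×ˢ (univ ×ˢ Icc (0 : ℝ) T)) p := by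
  have h0 : ((0 : Space d), (0 : ℝ)) ∈ (univ : Set (Space d)) ×ˢ Icc (0 : ℝ) T :=
    ⟨trivial, le_rfl, hT⟩
  have hC0 : 0 ≤ C := (abs_nonneg _).trans (hCv _ h0)
  -- Outside the ball of radius `R` the penalty is at least `δ R² ≥ 4 C`, a bound for the
  -- oscillation of `v - w`.
  obtain ⟨R, hR0, hR⟩ : ∃ R : ℝ, 0 ≤ R ∧ 4 * C ≤ δ * R ^ 2 :=
    ⟨Real.sqrt (4 * C / δ), Real.sqrt_nonneg _, by
      rw [Real.sq_sqrt (by positivity), mul_div_cancel₀ _ hδ.ne']⟩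
  set K : Set (Space d × ℝ) := Metric.closedBall 0 R ×ˢ Icc 0 T with hK
  have hKc : IsCompact K := (isCompact_closedBall 0 R).prod isCompact_Icc
  have hKs : K ⊆ univ ×ˢ Icc 0 T := prod_mono (subset_univ _) subset_rfl
  have h0K : ((0 : Space d), (0 : ℝ)) ∈ K := ⟨by simpa using hR0, le_rfl, hT⟩
  have hcont : ContinuousOn (doubled v w k δ η) (K ×ˢ K) := by
    have hv' : ContinuousOn (fun p : (Space d × ℝ) × (Space d × ℝ) => v p.1) (K ×ˢ K) :=
      hv.comp continuousOn_fst fun p hp => hKs hp.1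
    have hw' : ContinuousOn (fun p : (Space d × ℝ) × (Space d × ℝ) => w p.2) (K ×ˢ K) :=
      hw.comp continuousOn_snd fun p hp => hKs hp.2
    have hpen : ContinuousOn (fun p : (Space d × ℝ) × (Space d × ℝ) =>
        k * ‖p.1.1 - p.2.1‖ ^ 2 + k * (p.1.2 - p.2.2) ^ 2
          + δ * (‖p.1.1‖ ^ 2 + ‖p.2.1‖ ^ 2) + η * p.1.2) (K ×ˢ K) :=
      Continuous.continuousOn (by fun_prop)
    refine ((hv'.sub hw').sub hpen).congr fun p _ => ?_
    simp only [doubled, Pi.sub_apply]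
    ring
  obtain ⟨p, hp, hmax⟩ := (hKc.prod hKc).exists_isMaxOn ⟨((0, 0), (0, 0)), h0K, h0K⟩ hcont
  refine ⟨p, ⟨hKs hp.1, hKs hp.2⟩, fun q hq => ?_⟩
  by_cases hqK : q ∈ K ×ˢ K
  · exact hmax hqK
  have hzero : doubled v w k δ η ((0, 0), (0, 0)) ≤ doubled v w k δ η p :=
    hmax (a := ((0, 0), (0, 0))) ⟨h0K, h0K⟩
  refine le_trans ?_ hzero
  have hbig : R ^ 2 ≤ ‖q.1.1‖ ^ 2 + ‖q.2.1‖ ^ 2 := by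
    by_contra! hlt
    refine hqK ⟨⟨?_, hq.1.2⟩, ⟨?_, hq.2.2⟩⟩
    · exact mem_closedBall_zero_iff.2
        (le_of_sq_le_sq (by nlinarith [sq_nonneg ‖q.2.1‖]) hR0)
    · exact mem_closedBall_zero_iff.2
        (le_of_sq_le_sq (by nlinarith [sq_nonneg ‖q.1.1‖]) hR0)
  have hpen : 4 * C ≤ δ * (‖q.1.1‖ ^ 2 + ‖q.2.1‖ ^ 2) :=
    hR.trans (mul_le_mul_of_nonneg_left hbig hδ.le)
  have h1 := abs_le.1 (hCv _ hq.1)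
  have h2 := abs_le.1 (hCw _ hq.2)
  have h3 := abs_le.1 (hCv _ h0)
  have h4 := abs_le.1 (hCw _ h0)
  have h5 : 0 ≤ k * ‖q.1.1 - q.2.1‖ ^ 2 := by positivity
  have h6 : 0 ≤ k * (q.1.2 - q.2.2) ^ 2 := by positivity
  have h7 : 0 ≤ η * q.1.2 := mul_nonneg hη hq.1.2.1
  simp only [doubled, sub_self, norm_zero]
  linarith

/-- At an interior maximum of the doubled function, the two viscosity inequalities differ by `η` on
one side and by the confining penalty on the other. -/
theorem le_of_isMaxOn_doubled {H : Space d → ℝ} (hH : ∀ p q, H p ≤ H q + ‖p - q‖)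
    {v w : Space d × ℝ → ℝ} {T k δ η : ℝ} (hδ : 0 ≤ δ) (hv : IsSubsolution H T v)
    (hw : IsSupersolution H T w) {x y : Space d} {t s : ℝ} (ht : t ∈ Ioc 0 T) (hs : s ∈ Ioc 0 T)
    (hmax : IsMaxOn (doubled v w k δ η)
      ((univ ×ˢ Icc (0 : ℝ) T) ×ˢ (univ ×ˢ Icc (0 : ℝ) T)) ((x, t), (y, s))) :
    η ≤ 2 * δ * (‖x‖ + ‖y‖) := by
  have hIoc : Ioc 0 T ⊆ Icc 0 T := Ioc_subset_Icc_self
  have h1 : 2 * k * (t - s) + η ≤ H ((2 * k) • (x - y) + (2 * δ) • x) := by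
    have hg : ∀ r, HasDerivAt (fun r : ℝ => k * (r - s) ^ 2 + η * r) (2 * k * (r - s) + η) r := by
      intro r
      have := ((((hasDerivAt_id r).sub_const s).pow 2).const_mul k).add
        ((hasDerivAt_id r).const_mul η)
      refine this.congr_deriv ?_
      simp
      ring
    have key := hv.2 _ (fun r : ℝ => k * (r - s) ^ 2 + η * r) (contDiff_quadratic k δ y)
      (by fun_prop) x t ht fun z hz => ?_
    · rwa [(hasGradientAt_quadratic k δ x y).gradient,
        (hg t).hasDerivWithinAt.derivWithin (uniqueDiffOn_Ioc 0 T t ht)] at key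
    · have hle : doubled v w k δ η (z, (y, s)) ≤ doubled v w k δ η ((x, t), (y, s)) :=
        hmax (a := (z, (y, s))) ⟨⟨trivial, hIoc hz.2⟩, ⟨trivial, hIoc hs⟩⟩
      simp only [doubled] at hle
      simp only [mem_ofPred_eq]
      linarith
  have h2 : H (-((2 * k) • (y - x) + (2 * δ) • y)) ≤ 2 * k * (t - s) := by
    have hg : ∀ r, HasDerivAt (fun r : ℝ => -(k * (t - r) ^ 2)) (2 * k * (t - r)) r := by
      intro r
      have := ((((hasDerivAt_id r).const_sub t).pow 2).const_mul k).neg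
      refine this.congr_deriv ?_
      simp
      ring
    have hgrad : HasGradientAt (fun z : Space d => -(k * ‖z - x‖ ^ 2 + δ * ‖z‖ ^ 2))
        (-((2 * k) • (y - x) + (2 * δ) • y)) y := by
      have := (hasGradientAt_iff_hasFDerivAt.1 (hasGradientAt_quadratic k δ y x)).neg
      rw [hasGradientAt_iff_hasFDerivAt, map_neg]
      exact this
    have key := hw.2 _ (fun r : ℝ => -(k * (t - r) ^ 2)) (contDiff_quadratic k δ x).neg
      (by fun_prop) y s hs fun z hz => ?_
    · rwa [hgrad.gradient,
        (hg s).hasDerivWithinAt.derivWithin (uniqueDiffOn_Ioc 0 T s hs)] at key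
    · have hle : doubled v w k δ η ((x, t), z) ≤ doubled v w k δ η ((x, t), (y, s)) :=
        hmax (a := ((x, t), z)) ⟨⟨trivial, hIoc ht⟩, ⟨trivial, hIoc hz.2⟩⟩
      simp only [doubled] at hle
      rw [norm_sub_rev x z.1, norm_sub_rev x y] at hle
      simp only [mem_ofPred_eq]
      linarith
  have h3 := hH ((2 * k) • (x - y) + (2 * δ) • x) (-((2 * k) • (y - x) + (2 * δ) • y))
  have h4 : (2 * k) • (x - y) + (2 * δ) • x - -((2 * k) • (y - x) + (2 * δ) • y)
      = (2 * δ) • (x + y) := by module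
  rw [h4, norm_smul, Real.norm_of_nonneg (by positivity)] at h3
  have h5 := mul_le_mul_of_nonneg_left (norm_add_le x y) (by positivity : 0 ≤ 2 * δ)
  linarith

/-- Comparison principle for bounded uniformly continuous sub- and supersolutions. -/
theorem comparison {H : Space d → ℝ} (hH : ∀ p q, H p ≤ H q + ‖p - q‖) {v w : Space d × ℝ → ℝ}
    {T : ℝ} (hT : 0 < T) (hvb : IsBUCOn v (univ ×ˢ Icc 0 T)) (hwb : IsBUCOn w (univ ×ˢ Icc 0 T))
    (hv : IsSubsolution H T v) (hw : IsSupersolution H T w) (h0 : ∀ x, v (x, 0) ≤ w (x, 0)) :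
    ∀ z ∈ univ ×ˢ Icc 0 T, v z ≤ w z := by
  rintro ⟨x₁, t₁⟩ hz₁
  by_contra! hlt
  obtain ⟨C, hC1, hCv, hCw⟩ : ∃ C : ℝ, 1 ≤ C ∧ (∀ z ∈ univ ×ˢ Icc 0 T, |v z| ≤ C) ∧
      ∀ z ∈ univ ×ˢ Icc 0 T, |w z| ≤ C := by
    obtain ⟨⟨C₁, h₁⟩, -⟩ := hvb
    obtain ⟨⟨C₂, h₂⟩, -⟩ := hwb
    exact ⟨max 1 (max C₁ C₂), le_max_left _ _,
      fun z hz => (h₁ z hz).trans ((le_max_left _ _).trans (le_max_right _ _)),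
      fun z hz => (h₂ z hz).trans ((le_max_right _ _).trans (le_max_right _ _))⟩
  obtain ⟨σ, hσ, hσ₁⟩ : ∃ σ : ℝ, 0 < σ ∧ σ = v (x₁, t₁) - w (x₁, t₁) := ⟨_, by linarith, rfl⟩
  obtain ⟨ρ₁, hρ₁, huv⟩ := Metric.uniformContinuousOn_iff.1 hvb.2 (σ / 4) (by positivity)
  obtain ⟨ρ₂, hρ₂, huw⟩ := Metric.uniformContinuousOn_iff.1 hwb.2 (σ / 4) (by positivity)
  set ρ := min ρ₁ ρ₂
  have hρ : 0 < ρ := lt_min hρ₁ hρ₂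
  have hC0 : 0 < C := by linarith
  -- The maximum value exceeds `σ / 2`, so the penalties are below `2 C` there: this `k` forces the
  -- two doubled points to be closer than `ρ`.
  set k : ℝ := 2 * C / ρ ^ 2 with hk
  have hk0 : 0 < k := by positivity
  have hkρ : k * ρ ^ 2 = 2 * C := by rw [hk]; field_simp
  set η : ℝ := σ / (4 * T) with hη
  have hη0 : 0 < η := by positivity
  have hηT : η * T = σ / 4 := by rw [hη]; field_simp
  -- The first bound keeps the value at `(x₁, t₁)` above `σ / 2`, the second makes the error
  -- `2 δ (|x| + |y|) = O(√(C δ))` smaller than `η`.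
  obtain ⟨δ, hδ, hδ1, hδ2⟩ : ∃ δ : ℝ, 0 < δ ∧ δ * (2 * ‖x₁‖ ^ 2) < σ / 4 ∧
      32 * C * δ < η ^ 2 := by
    have e1 : Tendsto (fun δ : ℝ => δ * (2 * ‖x₁‖ ^ 2)) (𝓝[>] 0) (𝓝 0) := by
      have : Continuous fun δ : ℝ => δ * (2 * ‖x₁‖ ^ 2) := by fun_prop
      simpa using (this.tendsto 0).mono_left nhdsWithin_le_nhds
    have e2 : Tendsto (fun δ : ℝ => 32 * C * δ) (𝓝[>] 0) (𝓝 0) := by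
      have : Continuous fun δ : ℝ => 32 * C * δ := by fun_prop
      simpa using (this.tendsto 0).mono_left nhdsWithin_le_nhds
    have e0 : ∀ᶠ δ : ℝ in 𝓝[>] 0, 0 < δ := eventually_mem_nhdsWithin
    obtain ⟨δ, h⟩ := (e0.and ((e1.eventually_lt_const (by positivity : 0 < σ / 4)).and
      (e2.eventually_lt_const (by positivity : 0 < η ^ 2)))).exists
    exact ⟨δ, h.1, h.2.1, h.2.2⟩
  obtain ⟨⟨⟨x, t⟩, ⟨y, s⟩⟩, ⟨hxt, hys⟩, hmax⟩ :=
    exists_isMaxOn_doubled hT.le hk0.le hδ hη0.le hvb.2.continuousOn hwb.2.continuousOn hCv hCw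
  have hval : σ / 2 < doubled v w k δ η ((x, t), (y, s)) := by
    have hle : doubled v w k δ η ((x₁, t₁), (x₁, t₁)) ≤ doubled v w k δ η ((x, t), (y, s)) :=
      hmax (a := ((x₁, t₁), (x₁, t₁))) ⟨hz₁, hz₁⟩
    refine lt_of_lt_of_le ?_ hle
    have : η * t₁ ≤ η * T := mul_le_mul_of_nonneg_left hz₁.2.2 hη0.le
    simp only [doubled, sub_self, norm_zero]
    linarith
  simp only [doubled] at hval
  have hv1 := abs_le.1 (hCv _ hxt)
  have hw1 := abs_le.1 (hCw _ hys)
  have p1 : 0 ≤ k * ‖x - y‖ ^ 2 := by positivity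
  have p2 : 0 ≤ k * (t - s) ^ 2 := by positivity
  have p3 : 0 ≤ δ * ‖x‖ ^ 2 := by positivity
  have p4 : 0 ≤ δ * ‖y‖ ^ 2 := by positivity
  have p5 : 0 ≤ η * t := mul_nonneg hη0.le hxt.2.1
  have hxy : ‖x - y‖ < ρ := by
    refine lt_of_pow_lt_pow_left₀ 2 hρ.le (lt_of_mul_lt_mul_left ?_ hk0.le)
    linarith
  have hts : |t - s| < ρ := by
    refine lt_of_pow_lt_pow_left₀ 2 hρ.le (lt_of_mul_lt_mul_left ?_ hk0.le)
    rw [sq_abs]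
    linarith
  have hdist : dist (x, t) (y, s) < ρ := by
    rw [Prod.dist_eq, max_lt_iff, dist_eq_norm, Real.dist_eq]
    exact ⟨hxy, hts⟩
  have ht0 : t ∈ Ioc 0 T := by
    refine ⟨hxt.2.1.lt_of_ne ?_, hxt.2.2⟩
    rintro rfl
    have := huw _ hxt _ hys (hdist.trans_le (min_le_right _ _))
    rw [Real.dist_eq] at this
    linarith [(abs_lt.1 this).2, h0 x]
  have hs0 : s ∈ Ioc 0 T := by
    refine ⟨hys.2.1.lt_of_ne ?_, hys.2.2⟩
    rintro rfl
    have := huv _ hxt _ hys (hdist.trans_le (min_le_left _ _))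
    rw [Real.dist_eq] at this
    linarith [(abs_lt.1 this).2, h0 y]
  have hfin := le_of_isMaxOn_doubled hH hδ.le hv hw ht0 hs0 hmax
  have hsq : η ^ 2 ≤ (2 * δ * (‖x‖ + ‖y‖)) ^ 2 := pow_le_pow_left₀ hη0.le hfin 2
  have hsum : δ * (‖x‖ ^ 2 + ‖y‖ ^ 2) ≤ 2 * C := by linarith
  have : (2 * δ * (‖x‖ + ‖y‖)) ^ 2 ≤ 8 * δ * (δ * (‖x‖ ^ 2 + ‖y‖ ^ 2)) := by
    nlinarith [mul_nonneg (sq_nonneg δ) (sq_nonneg (‖x‖ - ‖y‖))]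
  have := mul_le_mul_of_nonneg_left hsum (by positivity : 0 ≤ 8 * δ)
  nlinarith

end Comparison

/-! ### The lattice model -/

section Lattice

variable {d : ℕ}

theorem le_driving (w : nbhd d → ℝ) (a : nbhd d) : w a ≤ driving d w :=
  Finset.le_sup' w (Finset.mem_univ a)

theorem driving_le {w : nbhd d → ℝ} {c : ℝ} (h : ∀ a, w a ≤ c) : driving d w ≤ c :=
  Finset.sup'_le _ _ fun a _ => h a

theorem mem_nbhd {a : Fin d → ℤ} :
    a ∈ nbhd d ↔ a = 0 ∨ (∃ i, Pi.single i 1 = a) ∨ ∃ i, -Pi.single i 1 = a := by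
  simp [nbhd]

theorem latticePoint_add (ε : ℝ) (k j : Fin d → ℤ) :
    latticePoint ε (k + j) = latticePoint ε k + latticePoint ε j := by
  ext i
  simp [latticePoint, mul_add]

theorem latticePoint_eq_smul {ε : ℝ} {a : Fin d → ℤ} (ha : a ∈ nbhd d) :
    ∃ b ∈ crossPolytope d, latticePoint ε a = ε • b := by
  have key : latticePoint ε a = ε • latticePoint 1 a := by
    ext i
    simp [latticePoint]
  refine ⟨latticePoint 1 a, ?_, key⟩
  have hsingle : ∀ i : Fin d,
      latticePoint 1 (Pi.single i 1) = EuclideanSpace.single i (1 : ℝ) := by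
    intro i
    ext j
    by_cases h : j = i <;> simp [latticePoint, Pi.single_apply, h]
  rcases mem_nbhd.1 ha with rfl | ⟨i, rfl⟩ | ⟨i, rfl⟩
  · simp [latticePoint, crossPolytope]
  · rw [hsingle]
    exact single_mem_crossPolytope i
  · have : latticePoint 1 (-Pi.single i 1) = -EuclideanSpace.single i (1 : ℝ) := by
      rw [← hsingle i]
      ext j
      simp [latticePoint]
    rw [this]
    exact neg_mem_crossPolytope (single_mem_crossPolytope i)

theorem surface_le_hopfLax {u₀ : Space d → ℝ} {C : ℝ} (hC : ∀ x, |u₀ x| ≤ C) {ε : ℝ}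
    (hε : 0 ≤ ε) (n : ℕ) (k : Fin d → ℤ) :
    surface (driving d) (fun k => u₀ (latticePoint ε k)) n k
      ≤ hopfLax u₀ (latticePoint ε k, ε * n) := by
  induction n generalizing k with
  | zero => simp [surface, hopfLax_zero]
  | succ n ih =>
    refine driving_le fun a => (ih (k + a)).trans ?_
    obtain ⟨b, hb, hab⟩ := latticePoint_eq_smul (ε := ε) a.2
    rw [latticePoint_add, hab, Nat.cast_succ, mul_add_one]
    exact hopfLax_step_le hC _ hε (by positivity) hb

/-- A nonzero lattice vector can be shortened by one in the `ℓ¹` norm by subtracting a neighbour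
of the origin. -/
theorem exists_mem_nbhd_sub {n : ℕ} {j : Fin d → ℤ} (hj : ∑ i, |j i| ≤ n + 1) :
    ∃ a ∈ nbhd d, ∑ i, |(j - a) i| ≤ n := by
  by_cases h0 : j = 0
  · exact ⟨0, zero_mem_nbhd d, by simp [h0]⟩
  obtain ⟨i₀, hi₀⟩ := Function.ne_iff.1 h0
  have key : ∀ c : ℤ, |j i₀ - c| = |j i₀| - 1 →
      ∑ i, |(j - (Pi.single i₀ c : Fin d → ℤ)) i| ≤ n := by
    intro c hc
    rw [← Finset.add_sum_erase _ _ (Finset.mem_univ i₀)] at hj ⊢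
    have : ∑ i ∈ Finset.univ.erase i₀, |(j - (Pi.single i₀ c : Fin d → ℤ)) i|
        = ∑ i ∈ Finset.univ.erase i₀, |j i| := by
      refine Finset.sum_congr rfl fun i hi => ?_
      simp [Pi.single_eq_of_ne (Finset.ne_of_mem_erase hi)]
    rw [this, Pi.sub_apply, Pi.single_eq_same, hc]
    linarith
  rcases lt_or_gt_of_ne hi₀ with hneg | hpos
  · rw [Pi.zero_apply] at hneg
    refine ⟨-Pi.single i₀ 1, mem_nbhd.2 (.inr (.inr ⟨i₀, rfl⟩)), ?_⟩
    rw [← Pi.single_neg]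
    refine key (-1) ?_
    rw [abs_of_neg hneg, abs_of_nonpos (by omega)]
    ring
  · rw [Pi.zero_apply] at hpos
    refine ⟨Pi.single i₀ 1, mem_nbhd.2 (.inr (.inl ⟨i₀, rfl⟩)), key 1 ?_⟩
    rw [abs_of_pos hpos, abs_of_nonneg (by omega)]

theorem le_surface (h : (Fin d → ℤ) → ℝ) (n : ℕ) (k j : Fin d → ℤ) (hj : ∑ i, |j i| ≤ n) :
    h (k + j) ≤ surface (driving d) h n k := by
  induction n generalizing k j with
  | zero =>
    have hj0 : j = 0 := by
      have := (Finset.sum_eq_zero_iff_of_nonneg fun i _ => abs_nonneg (j i)).1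
        (le_antisymm (by simpa using hj) (Finset.sum_nonneg fun i _ => abs_nonneg (j i)))
      ext i
      simpa using this i (Finset.mem_univ i)
    simp [surface, hj0]
  | succ n ih =>
    obtain ⟨a, ha, hja⟩ := exists_mem_nbhd_sub (n := n) (by exact_mod_cast hj)
    have h1 := ih (k + a) (j - a) hja
    rw [add_add_sub_cancel] at h1
    exact h1.trans (le_driving (fun a : nbhd d => surface (driving d) h n (k + a)) ⟨a, ha⟩)

/-- Rounding towards zero does not increase the absolute value. -/
theorem exists_int_abs_le (r : ℝ) : ∃ m : ℤ, |(m : ℝ)| ≤ |r| ∧ |(m : ℝ) - r| ≤ 1 := by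
  rcases le_total 0 r with hr | hr
  · refine ⟨⌊r⌋, ?_, ?_⟩
    · rw [abs_of_nonneg hr, abs_of_nonneg (by exact_mod_cast Int.floor_nonneg.2 hr)]
      exact Int.floor_le r
    · exact abs_le.2 ⟨by linarith [Int.lt_floor_add_one r], by linarith [Int.floor_le r]⟩
  · refine ⟨⌈r⌉, ?_, ?_⟩
    · rw [abs_of_nonpos hr, abs_of_nonpos (by exact_mod_cast Int.ceil_nonpos.2 hr)]
      linarith [Int.le_ceil r]
    · exact abs_le.2 ⟨by linarith [Int.le_ceil r], by linarith [Int.ceil_lt_add_one r]⟩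

theorem norm_le_of_abs_le {x : Space d} {c : ℝ} (h : ∀ i, |x i| ≤ c) : ‖x‖ ≤ d * c :=
  (norm_le_sum_abs x).trans <| (Finset.sum_le_sum fun i _ => h i).trans_eq (by simp)

theorem hopfLax_le_surface_add {u₀ : Space d → ℝ} {η δ : ℝ}
    (hδ : ∀ x y, dist x y < δ → |u₀ x - u₀ y| ≤ η) {ε : ℝ} (hε : 0 < ε) (hεδ : d * ε < δ) (n : ℕ)
    (k : Fin d → ℤ) :
    hopfLax u₀ (latticePoint ε k, ε * n)
      ≤ surface (driving d) (fun k => u₀ (latticePoint ε k)) n k + η := by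
  refine hopfLax_le fun b hb => ?_
  choose j hj1 hj2 using fun i => exists_int_abs_le (n * b i)
  have hj : ∑ i, |j i| ≤ n := by
    have : ∑ i, |(j i : ℝ)| ≤ n := by
      calc ∑ i, |(j i : ℝ)| ≤ ∑ i, n * |b i| := Finset.sum_le_sum fun i _ => by
            simpa [abs_mul] using hj1 i
        _ = n * ∑ i, |b i| := by rw [Finset.mul_sum]
        _ ≤ n := mul_le_of_le_one_right (by positivity) hb
    exact_mod_cast this
  have h1 := le_surface (fun k => u₀ (latticePoint ε k)) n k j hj
  have hdist : dist (latticePoint ε k + (ε * n) • b) (latticePoint ε (k + j)) < δ := by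
    rw [dist_comm, dist_eq_norm, latticePoint_add, add_sub_add_left_eq_sub]
    refine (norm_le_of_abs_le fun i => ?_).trans_lt hεδ
    have heq : (latticePoint ε j - (ε * n) • b) i = ε * (j i - n * b i) := by
      simp [latticePoint]
      ring
    rw [heq, abs_mul, abs_of_pos hε]
    exact mul_le_of_le_one_right hε.le (hj2 i)
  linarith [(abs_le.1 (hδ _ _ hdist)).2]

theorem abs_scaledHeight_sub_le {u₀ : Space d → ℝ} {C : ℝ} (hC : ∀ x, |u₀ x| ≤ C) {η δ : ℝ}
    (hδ : ∀ x y, dist x y < δ → |u₀ x - u₀ y| ≤ η) {ε : ℝ} (hε : 0 < ε) (hεδ : (d + 1) * ε < δ)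
    (x : Space d) {t : ℝ} (ht : 0 ≤ t) :
    |hopfLax u₀ (x, t) - scaledHeight u₀ ε (x, t)| ≤ 2 * η := by
  set n := ⌊t / ε⌋₊
  set k : Fin d → ℤ := fun i => ⌊x i / ε⌋
  have hη : 0 ≤ η := (abs_nonneg _).trans (hδ 0 0 (by
    rw [dist_self]
    exact lt_trans (by positivity) hεδ))
  have hup := surface_le_hopfLax hC hε.le n k
  have hlow := hopfLax_le_surface_add hδ hε (by linarith) n k
  have hx : ‖x - latticePoint ε k‖ ≤ d * ε := by
    refine norm_le_of_abs_le fun i => ?_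
    have heq : (x - latticePoint ε k) i = ε * Int.fract (x i / ε) := by
      simp only [latticePoint, PiLp.sub_apply, Int.fract, k]
      field_simp
    rw [heq, abs_of_nonneg (mul_nonneg hε.le (Int.fract_nonneg _))]
    exact mul_le_of_le_one_right hε.le (Int.fract_lt_one _).le
  have ht' : |t - ε * n| ≤ ε := by
    have h1 : (n : ℝ) ≤ t / ε := Nat.floor_le (by positivity)
    have h2 : t / ε < n + 1 := Nat.lt_floor_add_one _
    rw [le_div_iff₀ hε] at h1
    rw [div_lt_iff₀ hε] at h2
    exact abs_le.2 ⟨by linarith, by linarith⟩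
  have hu := abs_le.1 (abs_hopfLax_sub_le hC hδ (x := x) (y := latticePoint ε k) (t := t)
    (s := ε * n) (by linarith))
  have hsc : scaledHeight u₀ ε (x, t)
      = surface (driving d) (fun k => u₀ (latticePoint ε k)) n k := rfl
  rw [hsc]
  exact abs_le.2 ⟨by linarith [hu.1], by linarith [hu.2]⟩

theorem tendstoUniformlyOn_scaledHeight {u₀ : Space d → ℝ} (hu₀ : IsBUCOn u₀ univ) (T : ℝ) :
    TendstoUniformlyOn (fun ε : ℝ => scaledHeight u₀ ε) (hopfLax u₀) (𝓝[>] (0 : ℝ))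
      (univ ×ˢ Icc 0 T) := by
  obtain ⟨C, hC⟩ := hu₀.1
  rw [Metric.tendstoUniformlyOn_iff]
  intro η hη
  obtain ⟨δ, hδ, hmod⟩ := exists_modulus hu₀ (by positivity : 0 < η / 3)
  have htend : Tendsto (fun ε : ℝ => (d + 1) * ε) (𝓝[>] 0) (𝓝 0) := by
    have : Continuous fun ε : ℝ => ((d : ℝ) + 1) * ε := by fun_prop
    simpa using (this.tendsto 0).mono_left nhdsWithin_le_nhds
  filter_upwards [self_mem_nhdsWithin, htend.eventually_lt_const hδ] with ε hε hεδ z hz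
  have := abs_scaledHeight_sub_le (fun x => hC x trivial) hmod hε hεδ z.1 hz.2.1
  rw [Real.dist_eq]
  exact this.trans_lt (by linarith)

end Lattice

end LastPassage

theorem theorem4p1 (d : ℕ) (hd : 1 ≤ d) (T : ℝ) (hT : 0 < T)
    (u₀ : LastPassage.Space d → ℝ) (hu₀ : LastPassage.IsBUCOn u₀ Set.univ) :
    ∃ u : LastPassage.Space d × ℝ → ℝ,
      LastPassage.IsBUCSolution (LastPassage.hamiltonian d) T u₀ u ∧
      (∀ v : LastPassage.Space d × ℝ → ℝ,
        LastPassage.IsBUCSolution (LastPassage.hamiltonian d) T u₀ v →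
          Set.EqOn v u (Set.univ ×ˢ Set.Icc 0 T)) ∧
      TendstoLocallyUniformlyOn (fun ε : ℝ => LastPassage.scaledHeight u₀ ε) u
        (𝓝[>] (0 : ℝ)) (Set.univ ×ˢ Set.Icc 0 T) := by
  have hu := LastPassage.isBUCSolution_hopfLax hd T hu₀
  have hH := LastPassage.hamiltonian_le_add_norm_sub hd
  refine ⟨LastPassage.hopfLax u₀, hu, fun v hv z hz => le_antisymm ?_ ?_,
    (LastPassage.tendstoUniformlyOn_scaledHeight hu₀ T).tendstoLocallyUniformlyOn⟩
  · exact LastPassage.comparison hH hT hv.buc hu.buc hv.sub hu.super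
      (fun x => by rw [hv.initial, hu.initial]) z hz
  · exact LastPassage.comparison hH hT hu.buc hv.buc hu.sub hv.super
      (fun x => by rw [hv.initial, hu.initial]) z hz
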